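/- Let $(X,d,\nu)$ be a computable metric space, i.e. a metric space with a dense sequence $\nu:\mathbb N\to X$ such that the double sequence of reals $d(\nu(a),\nu(b))$ is computable. Let $\alpha\langle a,r\rangle$ denote the open ball with centre $\nu(a)$ and radius $\nu_{\mathbb Q^+}(r)$, where $\nu_{\mathbb Q^+}$ is a standard numbering of the positive rationals. Let $\mathcal K(X)$ be the class of compact subsets of $X$ (including $\emptyset$), with the minimal-cover representation $\delta_{\mathrm{mc}}$: a sequence $p\in\mathbb N^{\mathbb N}$ is a $\delta_{\mathrm{mc}}$-name of $K$ if and only if $\{p_i : i\in\mathbb N\}$ is the set of all codes $\langle w\rangle$ of words $w\in\mathbb N^*$ such that $K\subseteq\bigcup_{i<|w|}\alpha(w_i)$ and $\alpha(w_i)\cap K\neq\emptyset$ for all $i<|w|$. Let $\delta_{\mathbb N}(p)=p_0$, let $[\delta_{\mathrm{mc}},\delta_{\mathbb N}]$ be the product representation (names of the two components are interleaved), and let $\delta_{\mathrm{mc}}^*$ be the representation of the finite words over $\mathcal K(X)$ in which $n.\langle p^{(0)},p^{(1)},\dots\rangle$, with $\langle p^{(0)},p^{(1)},\dots\rangle(\langle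 i,j\rangle)=p^{(i)}_j$, names $K_0\dots K_{n-1}$ if and only if $p^{(i)}$ is a $\delta_{\mathrm{mc}}$-name of $K_i$ for each $i<n$. Then the multi-valued operation $S:\mathcal K(X)\times\mathbb N\rightrightarrows\mathcal K(X)^*$, $$S(K,l):=\Bigl\{K_0\dots K_{n-1} \;\Big|\; n\ge 1,\ K=\bigcup_{i<n}K_i,\ \max_{i<n}\operatorname{diam}K_i<2^{-l}\Bigr\}$$ (with $\operatorname{diam}\emptyset=0$) is total, i.e. $S(K,l)\neq\emptyset$ for all $K$ and $l$, and $([\delta_{\mathrm{mc}},\delta_{\mathbb N}],\delta_{\mathrm{mc}}^*)$-computable: there is a computable partial map $F$ on $\mathbb N^{\mathbb N}$ that sends every $[\delta_{\mathrm{mc}},\delta_{\mathbb N}]$-name of a pair $(K,l)$ to a $\delta_{\mathrm{mc}}^*$-name of an element of $S(K,l)$. -/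

import Mathlib

namespace CompMetric

/-- Baire space `ℕ^ℕ`. -/
abbrev Baire : Type := ℕ → ℕ

/-! ### Computable partial maps on Baire space -/

/-- Partial recursive functionals: partial maps `(p, n) ↦ Φ p n` which are partial recursive in the
argument `n` and the oracle `p`, by one and the same program for all oracles. The generators are
those of Mathlib's `Nat.Partrec` / `Nat.RecursiveIn`, with the oracle `p` as an input. -/
inductive PartrecFunctional : (Baire → ℕ →. ℕ) → Prop
  | zero : PartrecFunctional fun _ _ => Part.some 0
  | succ : PartrecFunctional fun _ n => Part.some (n + 1)
  | left : PartrecFunctional fun _ n => Part.some n.unpair.1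
  | right : PartrecFunctional fun _ n => Part.some n.unpair.2
  | oracle : PartrecFunctional fun p n => Part.some (p n)
  | pair {f g : Baire → ℕ →. ℕ} (hf : PartrecFunctional f) (hg : PartrecFunctional g) :
      PartrecFunctional fun p n => Nat.pair <$> f p n <*> g p n
  | comp {f g : Baire → ℕ →. ℕ} (hf : PartrecFunctional f) (hg : PartrecFunctional g) :
      PartrecFunctional fun p n => g p n >>= f p
  | prec {f g : Baire → ℕ →. ℕ} (hf : PartrecFunctional f) (hg : PartrecFunctional g) :
      PartrecFunctional fun p m =>
        let (a, n) := Nat.unpair m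
        n.rec (f p a) fun y IH => do
          let i ← IH
          g p (Nat.pair a (Nat.pair y i))
  | rfind {f : Baire → ℕ →. ℕ} (hf : PartrecFunctional f) :
      PartrecFunctional fun p a =>
        Nat.rfind fun n => (fun m => m = 0) <$> f p (Nat.pair a n)

/-- A partial map `F` on Baire space is computable if some oracle program, run with oracle `p`,
outputs the sequence `F p`; `F p` is defined exactly when all the entries are output. -/
def ComputableOnBaire (F : Baire →. Baire) : Prop :=
  ∃ Φ : Baire → ℕ →. ℕ, PartrecFunctional Φ ∧ ∀ p q, q ∈ F p ↔ ∀ n, q n ∈ Φ p n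

/-! ### Represented spaces -/

/-- A representation of `X`: a partial surjective map from Baire space to `X`, given by its graph
(`Names p x` says that `p` is a name of `x`). -/
structure Representation (X : Type*) where
  Names : Baire → X → Prop
  unique : ∀ p x y, Names p x → Names p y → x = y
  exists_name : ∀ x, ∃ p, Names p x

/-- `F` is a `(δ; δ')`-realiser of the multi-valued operation `f`, whose domain consists of the `x`
with `f x ≠ ∅`. -/
def IsRealiser {X Y : Type*} (δ : Representation X) (δ' : Representation Y)
    (F : Baire →. Baire) (f : X → Set Y) : Prop :=
  ∀ p x, δ.Names p x → (f x).Nonempty → ∃ q ∈ F p, ∃ y ∈ f x, δ'.Names q y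

/-- `f` is `(δ; δ')`-computable. -/
def IsComputable {X Y : Type*} (δ : Representation X) (δ' : Representation Y)
    (f : X → Set Y) : Prop :=
  ∃ F : Baire →. Baire, ComputableOnBaire F ∧ IsRealiser δ δ' F f

/-- The standard representation of `ℕ`: the first entry of the name is the number. -/
def natRep : Representation ℕ where
  Names p n := p 0 = n
  unique := by rintro p x y rfl rfl; rfl
  exists_name n := ⟨fun _ => n, rfl⟩

/-- The product representation: names `⟨p, q⟩` with entries `p 0, q 0, p 1, q 1, …`. -/
def Representation.prod {X Y : Type*} (δ : Representation X) (δ' : Representation Y) :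
    Representation (X × Y) where
  Names p z := δ.Names (fun i => p (2 * i)) z.1 ∧ δ'.Names (fun i => p (2 * i + 1)) z.2
  unique p x y hx hy := Prod.ext (δ.unique _ _ _ hx.1 hy.1) (δ'.unique _ _ _ hx.2 hy.2)
  exists_name z := by
    obtain ⟨p, hp⟩ := δ.exists_name z.1
    obtain ⟨q, hq⟩ := δ'.exists_name z.2
    refine ⟨fun n => if n % 2 = 0 then p (n / 2) else q (n / 2), ?_, ?_⟩
    · convert hp using 2 with i
      simp
    · convert hq using 2 with i
      have h₂ : (2 * i + 1) / 2 = i := by omega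
      simp [h₂]

/-- The representation `δ*` of finite words over `X`: a name is `n.⟨p⁽⁰⁾, p⁽¹⁾, …⟩`, where `n` is
the length of the word, `⟨p⁽⁰⁾, p⁽¹⁾, …⟩ ⟨i, j⟩ = p⁽ⁱ⁾ j`, and `p⁽ⁱ⁾` names the `i`-th letter for
every `i < n`. -/
def Representation.star {X : Type*} (δ : Representation X) : Representation (List X) where
  Names p w := p 0 = w.length ∧
    ∀ i : Fin w.length, δ.Names (fun j => p (Nat.pair i j + 1)) (w.get i)
  unique p x y hx hy := by
    refine List.ext_get (hx.1.symm.trans hy.1) fun i h₁ h₂ => ?_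
    exact δ.unique _ _ _ (hx.2 ⟨i, h₁⟩) (hy.2 ⟨i, h₂⟩)
  exists_name w := by
    choose P hP using δ.exists_name
    refine ⟨fun m => m.casesOn w.length fun k =>
      (w[k.unpair.1]?).elim 0 fun x => P x k.unpair.2, rfl, fun i => ?_⟩
    convert hP (w.get i) using 2 with j
    simp

/-! ### Computable metric spaces and the minimal-cover representation -/

/-- A standard total numbering of the rationals. -/
def ratNum (n : ℕ) : ℚ :=
  ((n.unpair.1.unpair.1 : ℚ) - (n.unpair.1.unpair.2 : ℚ)) / ((n.unpair.2 : ℚ) + 1)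

/-- A standard total numbering of the positive rationals. -/
def posRatNum (n : ℕ) : ℚ :=
  ((n.unpair.1 : ℚ) + 1) / ((n.unpair.2 : ℚ) + 1)

/-- A computable metric space structure on the metric space `X`: a dense sequence `ν` such that
the double sequence of reals `d (ν a, ν b)` is computable. -/
structure ComputableMetric (X : Type*) [MetricSpace X] where
  ν : ℕ → X
  dense : DenseRange ν
  computable_dist : ∃ f : ℕ × ℕ × ℕ → ℕ, Computable f ∧
    ∀ a b k, |dist (ν a) (ν b) - (ratNum (f (a, b, k)) : ℝ)| < (2 : ℝ)⁻¹ ^ k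

section
variable {X : Type*} [MetricSpace X] (C : ComputableMetric X)

/-- The ideal ball `α ⟨a, r⟩`. -/
def ComputableMetric.idealBall (c : ℕ) : Set X :=
  Metric.ball (C.ν c.unpair.1) (posRatNum c.unpair.2 : ℝ)

/-- The word `w` codes an ideal cover of `K` each of whose balls intersects `K`. -/
def ComputableMetric.IsMinCover (w : List ℕ) (K : Set X) : Prop :=
  K ⊆ (⋃ c ∈ w, C.idealBall c) ∧ ∀ c ∈ w, (C.idealBall c ∩ K).Nonempty

theorem ComputableMetric.exists_idealBall {x : X} {O : Set X} (hO : IsOpen O) (hx : x ∈ O) :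
    ∃ c, x ∈ C.idealBall c ∧ C.idealBall c ⊆ O := by
  obtain ⟨ε, hε, hb⟩ := Metric.isOpen_iff.1 hO x hx
  obtain ⟨k, hk⟩ := exists_nat_one_div_lt (half_pos hε)
  obtain ⟨a, ha⟩ := C.dense.exists_dist_lt x (ε := 1 / ((k : ℝ) + 1)) (by positivity)
  refine ⟨Nat.pair a (Nat.pair 0 k), ?_, fun y hy => hb ?_⟩
  · simpa [idealBall, posRatNum] using ha
  · simp only [idealBall, posRatNum, Nat.unpair_pair, Metric.mem_ball] at hy ⊢
    push_cast at hy
    have := dist_triangle_right y x (C.ν a)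
    rw [zero_add] at hy
    linarith

theorem ComputableMetric.exists_isMinCover {K O : Set X} (hK : IsCompact K) (hO : IsOpen O)
    (hKO : K ⊆ O) : ∃ w, C.IsMinCover w K ∧ ∀ c ∈ w, C.idealBall c ⊆ O := by
  choose! c hc using fun x (hx : x ∈ K) => C.exists_idealBall hO (hKO hx)
  obtain ⟨t, htK, ht⟩ := hK.elim_nhds_subcover (fun x => C.idealBall (c x))
    fun x hx => Metric.isOpen_ball.mem_nhds (hc x hx).1
  refine ⟨t.toList.map c, ⟨?_, ?_⟩, ?_⟩
  · simpa using ht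
  · simp only [List.mem_map, Finset.mem_toList]
    rintro _ ⟨x, hx, rfl⟩
    exact ⟨x, (hc x (htK x hx)).1, htK x hx⟩
  · simp only [List.mem_map, Finset.mem_toList]
    rintro _ ⟨x, hx, rfl⟩
    exact (hc x (htK x hx)).2

/-- The minimal-cover representation of the class of compact subsets (`∅` included): a name of `K`
is a list of (the codes of) exactly those ideal covers of `K` each of whose balls meets `K`. -/
def minCoverRep : Representation (TopologicalSpace.Compacts X) where
  Names p K := Set.range p = {a | ∃ w : List ℕ, a = Encodable.encode w ∧ C.IsMinCover w (K : Set X)}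
  unique := by
    have key : ∀ K L : TopologicalSpace.Compacts X,
        (∀ w, C.IsMinCover w (K : Set X) → C.IsMinCover w (L : Set X)) →
        (L : Set X) ⊆ K := by
      intro K L h x hx
      by_contra hxK
      obtain ⟨w, hw, hwx⟩ := C.exists_isMinCover K.isCompact (isOpen_compl_singleton (x := x))
        (fun y hy => by rintro rfl; exact hxK hy)
      obtain ⟨c, hc, hxc⟩ := Set.mem_iUnion₂.1 ((h w hw).1 hx)
      exact hwx c hc hxc rfl
    intro p K L hK hL
    have h : ∀ w, C.IsMinCover w (K : Set X) ↔ C.IsMinCover w (L : Set X) := by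
      intro w
      have := Set.ext_iff.1 (hK.symm.trans hL) (Encodable.encode w)
      simpa using this
    exact SetLike.coe_injective
      ((key L K fun w => (h w).2).antisymm (key K L fun w => (h w).1))
  exists_name K := by
    obtain ⟨w, hw, -⟩ := C.exists_isMinCover K.isCompact isOpen_univ (Set.subset_univ _)
    obtain ⟨p, hp⟩ := (Set.to_countable {a | ∃ w : List ℕ, a = Encodable.encode w ∧
      C.IsMinCover w (K : Set X)}).exists_eq_range ⟨_, w, rfl, hw⟩
    exact ⟨p, hp.symm⟩

end

/-- The nonempty finite words `K_0 … K_{n-1}` of compact sets with union `K` and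
`max_{i<n} diam K_i < 2^{-l}`. -/
def decompositions {X : Type*} [MetricSpace X]
    (z : TopologicalSpace.Compacts X × ℕ) : Set (List (TopologicalSpace.Compacts X)) :=
  {w | w ≠ [] ∧ (z.1 : Set X) = (⋃ L ∈ w, (L : Set X)) ∧
    ∀ L ∈ w, Metric.diam (L : Set X) < (2 : ℝ)⁻¹ ^ z.2}

end CompMetric

namespace CompMetric

/-! Put `L = l + 5` and select from the name of `K` minimal covers `w n` with all radii below `2⁻¹ ^
(n + L)`. Starting from the `i`-th ball of `w 0`, keep at each level the balls whose centre is close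
to that of a ball kept at the level before; closeness is tested on rational approximations to
distances. The resulting finite lists `pieces f L w i n` are computable, and the `i`-th part of `K`
is their `limitSet`.

Every ball of a minimal cover meets `K`, so every kept ball has a successor (`exists_successor`) and
lies on an infinite chain (`exists_chain`). By compactness the chain converges to a point of `K`
(`exists_limit`). Hence the centres kept at level `n` and the limit set approximate each other
within `8 * 2⁻¹ ^ (n + L)`. This makes being a minimal cover of the limit set semidecidable:
`coverTest` is sound at every stage (`isMinCover_of_coverTest`) and succeeds at some stage for every
minimal cover (`exists_coverTest`). Listing accepted words, with a known minimal cover in place of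
rejected ones, gives a name.

The parts exhaust `K`, because balls of consecutive covers sharing a point of `K` are close
(`exists_mem_limitSet_of_mem`). They are small because level `0` holds at most one ball
(`diam_limitSet_le`). -/

open Filter Topology

/-! ### Integer comparisons of coded rationals -/

/-- The integer form of the comparison `ratNum d + j / 2 ^ k < posRatNum r`. -/
def ratLt (j d k r : ℕ) : Bool :=
  decide (d.unpair.1.unpair.1 * 2 ^ k * (r.unpair.2 + 1) + j * (d.unpair.2 + 1) * (r.unpair.2 + 1) <
    (r.unpair.1 + 1) * (d.unpair.2 + 1) * 2 ^ k + d.unpair.1.unpair.2 * 2 ^ k * (r.unpair.2 + 1))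

theorem ratLt_iff (j d k r : ℕ) :
    ratLt j d k r = true ↔ (ratNum d : ℝ) + j * (2 : ℝ)⁻¹ ^ k < (posRatNum r : ℝ) := by
  simp only [ratLt, decide_eq_true_eq, ratNum, posRatNum]
  generalize d.unpair.1.unpair.1 = x
  generalize d.unpair.1.unpair.2 = y
  generalize d.unpair.2 = z
  generalize r.unpair.1 = u
  generalize r.unpair.2 = v
  rw [← Nat.cast_lt (α := ℝ)]
  push_cast
  rw [inv_pow, ← sub_pos, ← sub_pos (b := _ + _)]
  have h : ((u : ℝ) + 1) / (v + 1) - ((x - y) / (z + 1) + j * ((2 : ℝ) ^ k)⁻¹) =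
      ((u + 1) * (z + 1) * 2 ^ k + y * 2 ^ k * (v + 1) -
        (x * 2 ^ k * (v + 1) + j * (z + 1) * (v + 1))) / ((v + 1) * (z + 1) * 2 ^ k) := by
    field_simp
    ring
  rw [h, div_pos_iff_of_pos_right (by positivity)]

/-- The code of the rational number `3 / 2 ^ k`. -/
def threeDivTwoPow (k : ℕ) : ℕ := Nat.pair 2 (2 ^ k - 1)

theorem posRatNum_threeDivTwoPow (k : ℕ) : (posRatNum (threeDivTwoPow k) : ℝ) = 3 * (2 : ℝ)⁻¹ ^ k := by
  have : ((2 ^ k - 1 : ℕ) : ℝ) + 1 = 2 ^ k := by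
    rw [Nat.cast_sub Nat.one_le_two_pow]; push_cast; ring
  simp only [posRatNum, threeDivTwoPow, Nat.unpair_pair]
  push_cast
  rw [this, inv_pow]
  ring

/-- `posRatNum r < 2⁻¹ ^ k`, in integers. -/
def radiusLt (k r : ℕ) : Bool := decide ((r.unpair.1 + 1) * 2 ^ k < r.unpair.2 + 1)

theorem radiusLt_iff (k r : ℕ) : radiusLt k r = true ↔ (posRatNum r : ℝ) < (2 : ℝ)⁻¹ ^ k := by
  simp only [radiusLt, decide_eq_true_eq, posRatNum]
  rw [← Nat.cast_lt (α := ℝ), inv_pow]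
  push_cast
  rw [div_lt_iff₀ (by positivity), ← div_eq_inv_mul, lt_div_iff₀ (by positivity)]

/-! ### Chains of nearby balls and the decidable tests -/

section
variable (f : ℕ × ℕ × ℕ → ℕ)

/-- A decidable approximation to "the centres of the balls `a` and `c` are close at scale `2⁻¹ ^ k`". -/
def near (k a c : ℕ) : Bool := ratLt 0 (f (a.unpair.1, c.unpair.1, k)) k (threeDivTwoPow k)

/-- A decidable approximation to "the ball of radius `8 * 2⁻¹ ^ k` around the centre of `a` is
inside the ball `c`". -/
def inside (k a c : ℕ) : Bool := ratLt 9 (f (a.unpair.1, c.unpair.1, k)) k c.unpair.2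

/-- From covers `w n`, the balls that can be reached from the `i`-th ball of `w 0` along chains of
nearby balls. -/
def pieces (L : ℕ) (w : ℕ → List ℕ) (i : ℕ) : ℕ → List ℕ
  | 0 => (w 0)[i]?.toList
  | n + 1 => (w (n + 1)).filter fun c => (pieces L w i n).any fun a => near f (n + L) a c

/-- The decidable test at scale `2⁻¹ ^ k` for `v` to be a minimal cover of a set approximated by the
centres of the balls in `A`. -/
def coverTest (k : ℕ) (A v : List ℕ) : Bool :=
  (A.all fun a => v.any fun c => inside f k a c) && v.all fun c => A.any fun a => inside f k a c

variable {f} in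
theorem pieces_congr {L : ℕ} {w w' : ℕ → List ℕ} {i n : ℕ} (h : ∀ m ≤ n, w m = w' m) :
    pieces f L w i n = pieces f L w' i n := by
  induction n with
  | zero => simp [pieces, h]
  | succ n ih => simp only [pieces, h (n + 1) le_rfl, ih fun m hm => h m (by omega)]

end

/-- Balls with the centres of the balls in `A` and radius `9`. -/
def defaultCover (A : List ℕ) : List ℕ := A.map fun a => Nat.pair a.unpair.1 (Nat.pair 8 0)

/-! ### Fine covers, limit sets and convergence of chains -/

section
variable {X : Type*} [MetricSpace X] (C : ComputableMetric X)

/-- The centre of the ideal ball with code `c`. -/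
def ComputableMetric.centre (c : ℕ) : X := C.ν c.unpair.1

theorem ComputableMetric.mem_idealBall {c : ℕ} {x : X} :
    x ∈ C.idealBall c ↔ dist x (C.centre c) < (posRatNum c.unpair.2 : ℝ) := Iff.rfl

theorem ComputableMetric.exists_isMinCover_radiusLt {K : Set X} (hK : IsCompact K) (k : ℕ) :
    ∃ w, C.IsMinCover w K ∧ ∀ c ∈ w, radiusLt k c.unpair.2 = true := by
  have key : ∀ x : X, ∃ c, x ∈ C.idealBall c ∧ radiusLt k c.unpair.2 = true := by
    intro x
    obtain ⟨a, ha⟩ := C.dense.exists_dist_lt x (ε := 1 / ((2 ^ k : ℕ) + 1)) (by positivity)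
    -- The radius is `1 / (2 ^ k + 1)`, strictly below `2⁻¹ ^ k`.
    refine ⟨Nat.pair a (Nat.pair 0 (2 ^ k)), ?_, ?_⟩
    · simpa [ComputableMetric.idealBall, posRatNum] using ha
    · simp [radiusLt]
  choose c hc hr using key
  obtain ⟨t, htK, ht⟩ := hK.elim_nhds_subcover (fun x => C.idealBall (c x))
    fun x _ => Metric.isOpen_ball.mem_nhds (hc x)
  refine ⟨t.toList.map c, ⟨by simpa using ht, ?_⟩, ?_⟩
  · simp only [List.mem_map, Finset.mem_toList]
    rintro _ ⟨x, hx, rfl⟩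
    exact ⟨x, hc x, htK x hx⟩
  · simp only [List.mem_map, Finset.mem_toList]
    rintro _ ⟨x, _, rfl⟩
    exact hr x

/-- The points of `K` that are approximated by the centres of the balls in all `A n`. -/
def ComputableMetric.limitSet (L : ℕ) (K : Set X) (A : ℕ → List ℕ) : Set X :=
  {x ∈ K | ∀ n, ∃ a ∈ A n, dist x (C.centre a) ≤ 8 * (2 : ℝ)⁻¹ ^ (n + L)}

/-- Each level imposes membership in a finite union of closed balls, a closed condition on points of
`K`. -/
theorem ComputableMetric.isCompact_limitSet {L : ℕ} {K : Set X} (hK : IsCompact K)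
    (A : ℕ → List ℕ) : IsCompact (C.limitSet L K A) := by
  have : C.limitSet L K A = K ∩ ⋂ n, ⋃ a ∈ (A n).toFinset,
      Metric.closedBall (C.centre a) (8 * (2 : ℝ)⁻¹ ^ (n + L)) := by
    ext x
    simp [limitSet]
  rw [this]
  exact hK.inter_right (isClosed_iInter fun n => isClosed_biUnion_finset fun a _ =>
    Metric.isClosed_closedBall)

theorem tendsto_const_mul_half_pow (c : ℝ) (L : ℕ) :
    Tendsto (fun n => c * (2 : ℝ)⁻¹ ^ (n + L)) atTop (𝓝 0) := by
  have h := tendsto_pow_atTop_nhds_zero_of_lt_one (r := (2 : ℝ)⁻¹) (by norm_num) (by norm_num)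
  simpa using ((tendsto_add_atTop_iff_nat L).2 h).const_mul c

/-- A sequence of balls meeting the compact set `K`, with radii tending to zero and consecutive
centres close to each other, converges to a point of `K`. -/
theorem ComputableMetric.exists_limit {K : Set X} (hK : IsCompact K) {L : ℕ} {b : ℕ → ℕ}
    (hmeet : ∀ n, (C.idealBall (b n) ∩ K).Nonempty)
    (hrad : ∀ n, (posRatNum (b n).unpair.2 : ℝ) < (2 : ℝ)⁻¹ ^ (n + L))
    (hnear : ∀ n, dist (C.centre (b n)) (C.centre (b (n + 1))) ≤ 4 * (2 : ℝ)⁻¹ ^ (n + L)) :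
    ∃ x ∈ K, ∀ n, dist x (C.centre (b n)) ≤ 8 * (2 : ℝ)⁻¹ ^ (n + L) := by
  choose y hy hyK using hmeet
  obtain ⟨x, hxK, φ, hφ, hx⟩ := hK.tendsto_subseq hyK
  -- The bound in the form `c / 2 / 2 ^ n`, whose tail sums to `c / 2 ^ n`; with `c = 8 * 2⁻¹ ^ L`
  -- this yields the constant `8`.
  have hgeo : ∀ n, dist (C.centre (b n)) (C.centre (b (n + 1))) ≤
      8 * (2 : ℝ)⁻¹ ^ L / 2 / 2 ^ n := fun n => (hnear n).trans_eq (by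
    rw [pow_add, inv_pow, inv_pow]; ring)
  have hd : Tendsto (fun n => dist (y n) (C.centre (b n))) atTop (𝓝 0) :=
    squeeze_zero (fun _ => dist_nonneg)
      (fun n => ((C.mem_idealBall.1 (hy n)).trans (hrad n)).le)
      (by simpa using tendsto_const_mul_half_pow 1 L)
  -- The centres form a Cauchy sequence with a subsequence tending to `x`, so completeness of `X` is
  -- not needed.
  have hb : Tendsto (fun n => C.centre (b n)) atTop (𝓝 x) :=
    tendsto_nhds_of_cauchySeq_of_subseq (cauchySeq_of_le_geometric_two hgeo) hφ.tendsto_atTop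
      (tendsto_iff_of_dist (hd.comp hφ.tendsto_atTop) |>.1 hx)
  refine ⟨x, hxK, fun n => ?_⟩
  rw [dist_comm]
  refine (dist_le_of_le_geometric_two_of_tendsto hgeo hb n).trans_eq ?_
  rw [pow_add, inv_pow, inv_pow]; ring

/-- `f` computes approximations to the distances of the dense sequence. -/
def ComputableMetric.Approximates (f : ℕ × ℕ × ℕ → ℕ) : Prop :=
  ∀ a b k, |dist (C.ν a) (C.ν b) - (ratNum (f (a, b, k)) : ℝ)| < (2 : ℝ)⁻¹ ^ k

variable {C} {f : ℕ × ℕ × ℕ → ℕ}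

theorem dist_le_of_near (hf : C.Approximates f) {k a c : ℕ} (h : near f k a c = true) :
    dist (C.centre a) (C.centre c) ≤ 4 * (2 : ℝ)⁻¹ ^ k := by
  have h' := (ratLt_iff _ _ _ _).1 h
  rw [posRatNum_threeDivTwoPow] at h'
  have := (abs_lt.1 (hf a.unpair.1 c.unpair.1 k)).2
  simp only [ComputableMetric.centre]
  push_cast at h'
  linarith

/-- The threshold `3` leaves room for an error of one unit `2⁻¹ ^ k` either way: distances below `2`
units pass, and those that pass are below `4`. -/
theorem near_of_dist_lt (hf : C.Approximates f) {k a c : ℕ}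
    (h : dist (C.centre a) (C.centre c) < 2 * (2 : ℝ)⁻¹ ^ k) : near f k a c = true := by
  refine (ratLt_iff _ _ _ _).2 ?_
  rw [posRatNum_threeDivTwoPow]
  have := (abs_lt.1 (hf a.unpair.1 c.unpair.1 k)).1
  simp only [ComputableMetric.centre] at h
  push_cast
  linarith

/-- The margin of `9` units in `inside` pays `8` for the distance from `x` to the centre and `1` for
the error of `f`. -/
theorem mem_idealBall_of_inside (hf : C.Approximates f) {k a c : ℕ} (h : inside f k a c = true)
    {x : X} (hx : dist x (C.centre a) ≤ 8 * (2 : ℝ)⁻¹ ^ k) : x ∈ C.idealBall c := by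
  have h' := (ratLt_iff _ _ _ _).1 h
  have := (abs_lt.1 (hf a.unpair.1 c.unpair.1 k)).2
  have := dist_triangle x (C.centre a) (C.centre c)
  rw [C.mem_idealBall]
  simp only [ComputableMetric.centre] at *
  push_cast at h'
  linarith

/-- Here `18 = 8 + 1 + 9`: passing from `x` to the centre of `a`, the error of `f`, and the margin
in `inside`. -/
theorem inside_of_dist_lt (hf : C.Approximates f) {k a c : ℕ} {x : X}
    (hx : dist x (C.centre a) ≤ 8 * (2 : ℝ)⁻¹ ^ k)
    (h : dist x (C.centre c) + 18 * (2 : ℝ)⁻¹ ^ k < (posRatNum c.unpair.2 : ℝ)) :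
    inside f k a c = true := by
  refine (ratLt_iff _ _ _ _).2 ?_
  have := (abs_lt.1 (hf a.unpair.1 c.unpair.1 k)).1
  have := dist_triangle_left (C.centre a) (C.centre c) x
  simp only [ComputableMetric.centre] at *
  push_cast
  linarith

/-! ### The pieces and their minimal covers -/

/-- The sequence `w` consists of minimal covers of `K` by balls of radius less than
`2⁻¹ ^ (n + L)`. -/
structure IsFineCoverSeq (C : ComputableMetric X) (L : ℕ) (K : Set X) (w : ℕ → List ℕ) : Prop where
  isMinCover : ∀ n, C.IsMinCover (w n) K
  radius_lt : ∀ n, ∀ c ∈ w n, (posRatNum c.unpair.2 : ℝ) < (2 : ℝ)⁻¹ ^ (n + L)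

namespace IsFineCoverSeq

variable {L : ℕ} {K : Set X} {w : ℕ → List ℕ} {i : ℕ}

theorem mem_of_mem_pieces {n a : ℕ} (ha : a ∈ pieces f L w i n) : a ∈ w n := by
  cases n with
  | zero => simp only [pieces, Option.mem_toList] at ha; exact List.mem_of_getElem? ha
  | succ n => exact (List.mem_filter.1 ha).1

theorem near_of_mem (hf : C.Approximates f) (hw : IsFineCoverSeq C L K w) {n a c : ℕ}
    (ha : a ∈ w n) (hc : c ∈ w (n + 1)) {x : X} (hxa : x ∈ C.idealBall a)
    (hxc : x ∈ C.idealBall c) : near f (n + L) a c = true := by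
  apply near_of_dist_lt hf
  have h1 := (C.mem_idealBall.1 hxa).trans (hw.radius_lt n a ha)
  have h2 := (C.mem_idealBall.1 hxc).trans (hw.radius_lt (n + 1) c hc)
  have h3 := dist_triangle_left (C.centre a) (C.centre c) x
  have h4 : (2 : ℝ)⁻¹ ^ (n + 1 + L) ≤ (2 : ℝ)⁻¹ ^ (n + L) :=
    pow_le_pow_of_le_one (by norm_num) (by norm_num) (by omega)
  linarith

/-- A point of `K` in the ball `a` is covered again at the next level, and two balls sharing a point
are near. Minimality of the cover supplies that point. -/
theorem exists_successor (hf : C.Approximates f) (hw : IsFineCoverSeq C L K w) {n a : ℕ}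
    (ha : a ∈ pieces f L w i n) : ∃ c ∈ pieces f L w i (n + 1), near f (n + L) a c = true := by
  have haw := mem_of_mem_pieces ha
  obtain ⟨x, hxa, hxK⟩ := (hw.isMinCover n).2 a haw
  obtain ⟨c, hc, hxc⟩ := Set.mem_iUnion₂.1 ((hw.isMinCover (n + 1)).1 hxK)
  have hn := hw.near_of_mem hf haw hc hxa hxc
  exact ⟨c, List.mem_filter.2 ⟨hc, List.any_eq_true.2 ⟨a, ha, hn⟩⟩, hn⟩

theorem exists_chain (hf : C.Approximates f) (hw : IsFineCoverSeq C L K w) {n a : ℕ}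
    (ha : a ∈ pieces f L w i n) : ∃ b : ℕ → ℕ, b n = a ∧
      ∀ m, b m ∈ pieces f L w i m ∧ near f (m + L) (b m) (b (m + 1)) = true := by
  -- A chain starting at level `n` extends down to level `0`, since the filter in `pieces`
  -- guarantees a predecessor for each kept ball.
  have down : ∀ n, ∀ u : ℕ → ℕ,
      (∀ m, u m ∈ pieces f L w i (n + m) ∧ near f (n + m + L) (u m) (u (m + 1)) = true) →
      ∃ b : ℕ → ℕ, (∀ m, b (n + m) = u m) ∧
        ∀ m, b m ∈ pieces f L w i m ∧ near f (m + L) (b m) (b (m + 1)) = true := by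
    intro n
    induction n with
    | zero => exact fun u hu => ⟨u, by simp, by simpa using hu⟩
    | succ n ih =>
      intro u hu
      obtain ⟨a, ha, hn⟩ := List.any_eq_true.1 (List.mem_filter.1 (hu 0).1).2
      obtain ⟨b, hbu, hb⟩ := ih (fun m => m.casesOn a u) (by
        rintro (_ | m)
        · exact ⟨ha, hn⟩
        · simpa [Nat.add_assoc, Nat.add_comm 1] using hu m)
      exact ⟨b, fun m => by rw [Nat.add_assoc, Nat.add_comm 1]; exact hbu (m + 1), hb⟩
  choose! s hs using fun (m c : ℕ) (hc : c ∈ pieces f L w i m) => hw.exists_successor hf hc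
  -- The upward half of the chain: chosen successors iterated from `a`.
  let u : ℕ → ℕ := fun m => Nat.rec a (fun m c => s (n + m) c) m
  have hu : ∀ m, u m ∈ pieces f L w i (n + m) := by
    intro m
    induction m with
    | zero => exact ha
    | succ m ih => exact (hs _ _ ih).1
  obtain ⟨b, hbu, hb⟩ := down n u fun m => ⟨hu m, (hs _ _ (hu m)).2⟩
  exact ⟨b, hbu 0, hb⟩

/-- The limit of a chain through `a` lies in the limit set, as the chain itself supplies a witness
at every level. -/
theorem exists_mem_limitSet (hf : C.Approximates f) (hw : IsFineCoverSeq C L K w)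
    (hK : IsCompact K) {n a : ℕ} (ha : a ∈ pieces f L w i n) :
    ∃ x ∈ C.limitSet L K (pieces f L w i), dist x (C.centre a) ≤ 8 * (2 : ℝ)⁻¹ ^ (n + L) := by
  obtain ⟨b, rfl, hb⟩ := hw.exists_chain hf ha
  have hbw := fun m => mem_of_mem_pieces (hb m).1
  obtain ⟨x, hxK, hx⟩ := C.exists_limit hK (L := L) (b := b)
    (fun m => (hw.isMinCover m).2 _ (hbw m)) (fun m => hw.radius_lt m _ (hbw m))
    (fun m => dist_le_of_near hf (hb m).2)
  exact ⟨x, ⟨hxK, fun m => ⟨b m, (hb m).1, hx m⟩⟩, hx n⟩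

theorem isMinCover_of_coverTest (hf : C.Approximates f) (hw : IsFineCoverSeq C L K w)
    (hK : IsCompact K) {n : ℕ} {v : List ℕ}
    (h : coverTest f (n + L) (pieces f L w i n) v = true) :
    C.IsMinCover v (C.limitSet L K (pieces f L w i)) := by
  simp only [coverTest, Bool.and_eq_true, List.all_eq_true, List.any_eq_true] at h
  refine ⟨fun x hx => ?_, fun c hc => ?_⟩
  · obtain ⟨a, ha, hxa⟩ := hx.2 n
    obtain ⟨c, hc, hac⟩ := h.1 a ha
    exact Set.mem_iUnion₂.2 ⟨c, hc, mem_idealBall_of_inside hf hac hxa⟩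
  · obtain ⟨a, ha, hac⟩ := h.2 c hc
    obtain ⟨x, hx, hxa⟩ := hw.exists_mem_limitSet hf hK ha
    exact ⟨x, mem_idealBall_of_inside hf hac hxa, hx⟩

/-- For a ball meeting the limit set, a common point has positive slack, which eventually exceeds
the error. For the covering half, compactness makes the slack uniform. -/
theorem exists_coverTest (hf : C.Approximates f) (hw : IsFineCoverSeq C L K w)
    (hK : IsCompact K) {v : List ℕ}
    (h : C.IsMinCover v (C.limitSet L K (pieces f L w i))) :
    ∃ n, coverTest f (n + L) (pieces f L w i n) v = true := by
  have hev : ∀ (x : X) (c : ℕ), x ∈ C.idealBall c →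
      ∀ᶠ n in atTop, dist x (C.centre c) + 18 * (2 : ℝ)⁻¹ ^ (n + L) < (posRatNum c.unpair.2 : ℝ) := by
    intro x c hx
    have := (tendsto_const_mul_half_pow 18 L).const_add (dist x (C.centre c))
    rw [add_zero] at this
    exact this.eventually_lt_const (C.mem_idealBall.1 hx)
  have h2 : ∀ᶠ n in atTop, ∀ c ∈ v.toFinset, ∃ a ∈ pieces f L w i n, inside f (n + L) a c = true := by
    refine (Filter.eventually_all_finset _).2 fun c hc => ?_
    obtain ⟨x, hxc, hx⟩ := h.2 c (List.mem_toFinset.1 hc)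
    filter_upwards [hev x c hxc] with n hn
    obtain ⟨a, ha, hxa⟩ := hx.2 n
    exact ⟨a, ha, inside_of_dist_lt hf hxa hn⟩
  -- The balls of `v` shrunk by the error at stage `m`: an increasing family of open sets, so a
  -- single one already covers the compact limit set.
  let U : ℕ → Set X := fun m => ⋃ c ∈ v, Metric.ball (C.centre c)
    ((posRatNum c.unpair.2 : ℝ) - 18 * (2 : ℝ)⁻¹ ^ (m + L))
  have hmono : Monotone U := fun m m' hm =>
    Set.iUnion₂_mono fun c _ => Metric.ball_subset_ball (by
      have : (2 : ℝ)⁻¹ ^ (m' + L) ≤ (2 : ℝ)⁻¹ ^ (m + L) :=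
        pow_le_pow_of_le_one (by norm_num) (by norm_num) (by omega)
      linarith)
  obtain ⟨N, hN⟩ := (C.isCompact_limitSet hK (pieces f L w i)).elim_directed_cover U
    (fun m => isOpen_biUnion fun _ _ => Metric.isOpen_ball) (fun x hx => by
      obtain ⟨c, hc, hxc⟩ := Set.mem_iUnion₂.1 (h.1 hx)
      obtain ⟨m, hm⟩ := (hev x c hxc).exists
      exact Set.mem_iUnion.2 ⟨m, Set.mem_iUnion₂.2 ⟨c, hc, by
        rw [Metric.mem_ball]; linarith⟩⟩) hmono.directed_le
  obtain ⟨n, hn, hNn⟩ := (h2.and (eventually_ge_atTop N)).exists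
  refine ⟨n, ?_⟩
  simp only [coverTest, Bool.and_eq_true, List.all_eq_true, List.any_eq_true]
  refine ⟨fun a ha => ?_, fun c hc => hn c (List.mem_toFinset.2 hc)⟩
  obtain ⟨x, hx, hxa⟩ := hw.exists_mem_limitSet hf hK ha
  obtain ⟨c, hc, hxc⟩ := Set.mem_iUnion₂.1 (hmono hNn (hN hx))
  refine ⟨c, hc, inside_of_dist_lt hf hxa ?_⟩
  rw [Metric.mem_ball] at hxc
  linarith

/-- Radius `9` exceeds the level-`0` error `8 * 2⁻¹ ^ L`, so no test is needed. With no kept ball,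
both the cover and the limit set are empty. -/
theorem isMinCover_defaultCover (hf : C.Approximates f) (hw : IsFineCoverSeq C L K w)
    (hK : IsCompact K) :
    C.IsMinCover (defaultCover (pieces f L w i 0)) (C.limitSet L K (pieces f L w i)) := by
  have h1 : (2 : ℝ)⁻¹ ^ (0 + L) ≤ 1 := pow_le_one₀ (by norm_num) (by norm_num)
  have key : ∀ (x : X) (a : ℕ), dist x (C.centre a) ≤ 8 * (2 : ℝ)⁻¹ ^ (0 + L) →
      x ∈ C.idealBall (Nat.pair a.unpair.1 (Nat.pair 8 0)) := by
    intro x a hx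
    rw [C.mem_idealBall]
    simp only [ComputableMetric.centre, Nat.unpair_pair, posRatNum] at hx ⊢
    norm_num
    linarith
  refine ⟨fun x hx => ?_, fun c hc => ?_⟩
  · obtain ⟨a, ha, hxa⟩ := hx.2 0
    exact Set.mem_iUnion₂.2 ⟨_, List.mem_map_of_mem ha, key x a hxa⟩
  · obtain ⟨a, ha, rfl⟩ := List.mem_map.1 hc
    obtain ⟨x, hx, hxa⟩ := hw.exists_mem_limitSet hf hK ha
    exact ⟨x, key x a hxa, hx⟩

/-- Balls chosen around the same `x` at all levels form a chain, whose first ball determines the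
index `i`. -/
theorem exists_mem_limitSet_of_mem (hf : C.Approximates f) (hw : IsFineCoverSeq C L K w) {x : X}
    (hx : x ∈ K) : ∃ i < (w 0).length, x ∈ C.limitSet L K (pieces f L w i) := by
  choose b hb hxb using fun n => Set.mem_iUnion₂.1 ((hw.isMinCover n).1 hx)
  obtain ⟨i, hi, hib⟩ := List.getElem_of_mem (hb 0)
  have hp : ∀ n, b n ∈ pieces f L w i n := by
    intro n
    induction n with
    | zero => simp [pieces, hi, hib]
    | succ n ih =>
      exact List.mem_filter.2 ⟨hb _, List.any_eq_true.2
        ⟨b n, ih, hw.near_of_mem hf (hb n) (hb (n + 1)) (hxb n) (hxb (n + 1))⟩⟩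
  refine ⟨i, hi, hx, fun n => ⟨b n, hp n, ?_⟩⟩
  have h1 := (C.mem_idealBall.1 (hxb n)).trans (hw.radius_lt n _ (hb n))
  have h2 : (0 : ℝ) < (2 : ℝ)⁻¹ ^ (n + L) := by positivity
  linarith

theorem diam_limitSet_le :
    Metric.diam (C.limitSet L K (pieces f L w i)) ≤ 16 * (2 : ℝ)⁻¹ ^ L := by
  refine Metric.diam_le_of_forall_dist_le (by positivity) fun x hx y hy => ?_
  obtain ⟨a, ha, hxa⟩ := hx.2 0
  obtain ⟨b, hb, hyb⟩ := hy.2 0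
  simp only [pieces, Option.mem_toList] at ha hb
  obtain rfl : a = b := Option.some_injective _ (ha.symm.trans hb)
  have := dist_triangle_right x y (C.centre a)
  rw [zero_add] at hxa hyb
  linarith

end IsFineCoverSeq
end

/-! ### Computability of list operations -/

section
variable {α β γ σ : Type*} [Primcodable α] [Primcodable β] [Primcodable γ] [Primcodable σ]

/-- The fold becomes a recursion on the index of the next entry, ending at the length of the list.
-/
theorem computable_list_foldl {f : α → List β} {g : α → σ} {h : α → σ × β → σ}
    (hf : Computable f) (hg : Computable g) (hh : Computable₂ h) :
    Computable fun a => (f a).foldl (fun s b => h a (s, b)) (g a) := by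
  have hstep : Computable₂ fun (a : α) (p : ℕ × σ) =>
      (((f a)[p.1]?).map fun b => h a (p.2, b)).getD p.2 := by
    refine Computable.option_getD (Computable.option_map
      (Computable.list_getElem?.comp (hf.comp .fst) (Computable.fst.comp .snd)) ?_)
      (Computable.snd.comp .snd)
    exact hh.comp (Computable.fst.comp .fst)
      (Computable.pair (Computable.snd.comp (Computable.snd.comp .fst)) .snd)
  refine (Computable.nat_rec (Computable.list_length.comp hf) hg hstep).of_eq fun a => ?_
  have key : ∀ n, n ≤ (f a).length →
      (Nat.rec (g a) (fun y s => (((f a)[y]?).map fun b => h a (s, b)).getD s) n : σ) =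
        ((f a).take n).foldl (fun s b => h a (s, b)) (g a) := by
    intro n
    induction n with
    | zero => simp
    | succ n ih =>
      intro hn
      have hn' : n < (f a).length := hn
      simp only [List.take_add_one, List.foldl_append, ← ih hn'.le]
      simp [hn']
  simpa using key _ le_rfl

theorem computable_list_any {f : α → List β} {p : α → β → Bool}
    (hf : Computable f) (hp : Computable₂ p) : Computable fun a => (f a).any (p a) := by
  refine (computable_list_foldl (h := fun a (s : Bool × β) => s.1 || p a s.2) hf
    (Computable.const false) ?_).of_eq fun a => ?_
  · exact Primrec.or.to_comp.comp (Computable.fst.comp .snd)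
      (hp.comp .fst (Computable.snd.comp .snd))
  · have key : ∀ (l : List β) (s : Bool),
        l.foldl (fun s b => s || p a b) s = (s || l.any (p a)) := by
      intro l
      induction l with
      | nil => simp
      | cons b l ih => intro s; simp [ih, Bool.or_assoc]
    simpa using key (f a) false

theorem computable_list_all {f : α → List β} {p : α → β → Bool}
    (hf : Computable f) (hp : Computable₂ p) : Computable fun a => (f a).all (p a) :=
  (Primrec.not.to_comp.comp (computable_list_any (p := fun a b => !p a b) hf
    (Primrec.not.to_comp.comp hp))).of_eq fun a => by simp [List.all_eq_not_any_not]

theorem computable_list_filter {f : α → List β} {p : α → β → Bool}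
    (hf : Computable f) (hp : Computable₂ p) : Computable fun a => (f a).filter (p a) := by
  refine (computable_list_foldl
    (h := fun a (s : List β × β) => bif p a s.2 then s.1 ++ [s.2] else s.1) hf
    (Computable.const []) ?_).of_eq fun a => ?_
  · exact Computable.cond (hp.comp .fst (Computable.snd.comp .snd))
      (Computable.list_concat.comp (Computable.fst.comp .snd) (Computable.snd.comp .snd))
      (Computable.fst.comp .snd)
  · have key : ∀ (l : List β) (s : List β),
        l.foldl (fun s b => bif p a b then s ++ [b] else s) s = s ++ l.filter (p a) := by
      intro l
      induction l with
      | nil => simp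
      | cons b l ih => intro s; cases h : p a b <;> simp [ih, h]
    simpa using key (f a) []

end

/-! ### Functionals that are total on a class of oracles -/

theorem PartrecFunctional.of_partrec {f : ℕ →. ℕ} (hf : Nat.Partrec f) :
    PartrecFunctional fun _ n => f n := by
  induction hf with
  | zero => exact .zero
  | succ => exact .succ
  | left => exact .left
  | right => exact .right
  | pair _ _ hf hg => exact .pair hf hg
  | comp _ _ hf hg => exact .comp hf hg
  | prec _ _ hf hg => exact .prec hf hg
  | rfind _ hf => exact .rfind hf

/-- One oracle program computes `F p` for all oracles `p ∈ D`. -/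
def ComputesOn (D : Set Baire) (F : Baire → ℕ → ℕ) : Prop :=
  ∃ Φ, PartrecFunctional Φ ∧ ∀ p ∈ D, ∀ n, Φ p n = Part.some (F p n)

namespace ComputesOn

variable {D : Set Baire} {F G : Baire → ℕ → ℕ}

theorem of_computable {g : ℕ → ℕ} (hg : Computable g) : ComputesOn D fun _ => g :=
  ⟨_, .of_partrec (Partrec.nat_iff.1 hg), fun _ _ _ => rfl⟩

theorem oracle : ComputesOn D fun p => p := ⟨_, .oracle, fun _ _ _ => rfl⟩

theorem comp (hF : ComputesOn D F) (hG : ComputesOn D G) :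
    ComputesOn D fun p n => F p (G p n) := by
  obtain ⟨Φ, hΦ, hΦF⟩ := hF
  obtain ⟨Ψ, hΨ, hΨG⟩ := hG
  exact ⟨_, hΦ.comp hΨ, fun p hp n =>
    ((congrArg (fun x => Part.bind x (Φ p)) (hΨG p hp n)).trans (Part.bind_some _ _)).trans
      (hΦF p hp _)⟩

theorem pair (hF : ComputesOn D F) (hG : ComputesOn D G) :
    ComputesOn D fun p n => Nat.pair (F p n) (G p n) := by
  obtain ⟨Φ, hΦ, hΦF⟩ := hF
  obtain ⟨Ψ, hΨ, hΨG⟩ := hG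
  exact ⟨_, hΦ.pair hΨ, fun p hp n => by simp [hΦF p hp, hΨG p hp, Seq.seq]⟩

theorem map {g : ℕ → ℕ} (hg : Computable g) (hF : ComputesOn D F) :
    ComputesOn D fun p n => g (F p n) :=
  (of_computable hg).comp hF

theorem map₂ {g : ℕ → ℕ → ℕ} (hg : Computable₂ g) (hF : ComputesOn D F) (hG : ComputesOn D G) :
    ComputesOn D fun p n => g (F p n) (G p n) := by
  have h : Computable fun m : ℕ => g m.unpair.1 m.unpair.2 :=
    hg.comp (Computable.fst.comp .unpair) (Computable.snd.comp .unpair)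
  simpa using map h (hF.pair hG)

/-- Unbounded search for the least zero; `hF` says that it stops exactly at `F p n` for oracles in
`D`. -/
theorem find {P : Baire → ℕ → ℕ → Bool}
    (hP : ComputesOn D fun p m => bif P p m.unpair.1 m.unpair.2 then 0 else 1)
    (hF : ∀ p ∈ D, ∀ n, P p n (F p n) = true ∧ ∀ j < F p n, P p n j = false) :
    ComputesOn D F := by
  obtain ⟨Φ, hΦ, hΦF⟩ := hP
  refine ⟨_, hΦ.rfind, fun p hp n => Part.eq_some_iff.2 (Nat.mem_rfind.2 ⟨?_, fun {j} hj => ?_⟩)⟩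
  · simp [hΦF p hp, (hF p hp n).1]
  · simp [hΦF p hp, (hF p hp n).2 j hj]

/-- Collects a finite initial segment of an oracle-dependent sequence into one number, so that
ordinary computable functions apply to it. -/
theorem map_range (hF : ComputesOn D F) :
    ComputesOn D fun p n => Encodable.encode ((List.range n).map (F p)) := by
  have happ : Computable₂ fun (e x : ℕ) =>
      Encodable.encode (Denumerable.ofNat (List ℕ) e ++ [x]) :=
    Computable.encode.comp (Computable.list_concat.comp
      ((Computable.ofNat (List ℕ)).comp .fst) .snd)
  have hr : Computable fun m : ℕ => m.unpair.2 := Computable.snd.comp .unpair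
  have hl : Computable fun m : ℕ => m.unpair.1 := Computable.fst.comp .unpair
  obtain ⟨Φ, hΦ, hΦF⟩ := map₂ happ (of_computable (hr.comp hr))
    (hF.comp (of_computable (hl.comp hr)))
  obtain ⟨Ψ, hΨ, hΨF⟩ := of_computable (D := D) (Computable.const (Encodable.encode ([] : List ℕ)))
  obtain ⟨Θ, hΘ, hΘF⟩ := of_computable (D := D)
    (g := fun n => Nat.pair 0 n) (Primrec₂.natPair.comp (.const 0) .id).to_comp
  refine ⟨_, (hΨ.prec hΦ).comp hΘ, fun p hp n => ?_⟩
  simp only [hΘF p hp, Part.bind_eq_bind, Part.bind_some, Nat.unpair_pair]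
  induction n with
  | zero => simp [hΨF p hp]
  | succ n ih =>
    refine (congrArg (fun x => Part.bind x _) ih).trans ?_
    simp only [Part.bind_some, hΦF p hp]
    simp [List.range_succ]

end ComputesOn

/-- The domain of `G` consists of the oracles on which the program outputs every entry; it contains
`D`. -/
theorem ComputesOn.exists_computableOnBaire {D : Set Baire} {F : Baire → ℕ → ℕ}
    (hF : ComputesOn D F) :
    ∃ G : Baire →. Baire, ComputableOnBaire G ∧ ∀ p ∈ D, F p ∈ G p := by
  obtain ⟨Φ, hΦ, hΦF⟩ := hF
  let G : Baire →. Baire := fun p => ⟨∀ n, (Φ p n).Dom, fun h n => (Φ p n).get (h n)⟩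
  have hG : ∀ p q, q ∈ G p ↔ ∀ n, q n ∈ Φ p n := fun p q =>
    ⟨fun ⟨h, hq⟩ n => ⟨h n, congrFun hq n⟩,
      fun h => ⟨fun n => (h n).1, funext fun n => (h n).2⟩⟩
  exact ⟨G, ⟨Φ, hΦ, hG⟩, fun p hp => (hG p _).2 fun n => by rw [hΦF p hp]; exact Part.mem_some _⟩

/-! ### Computability of the tests -/

section
variable {α : Type*} [Primcodable α]

theorem primrec_unpair_fst : Primrec fun n : ℕ => n.unpair.1 := Primrec.fst.comp .unpair

theorem primrec_unpair_snd : Primrec fun n : ℕ => n.unpair.2 := Primrec.snd.comp .unpair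

theorem primrec_two_pow : Primrec fun k : ℕ => 2 ^ k :=
  (Primrec₂.unpaired'.1 Nat.Primrec.pow).comp (Primrec.const 2) .id

theorem primrec_ratLt {j d k r : α → ℕ} (hj : Primrec j) (hd : Primrec d) (hk : Primrec k)
    (hr : Primrec r) : Primrec fun a => ratLt (j a) (d a) (k a) (r a) := by
  have hx := primrec_unpair_fst.comp (primrec_unpair_fst.comp hd)
  have hy := primrec_unpair_snd.comp (primrec_unpair_fst.comp hd)
  have hz := Primrec.succ.comp (primrec_unpair_snd.comp hd)
  have hu := Primrec.succ.comp (primrec_unpair_fst.comp hr)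
  have hv := Primrec.succ.comp (primrec_unpair_snd.comp hr)
  have hp := primrec_two_pow.comp hk
  have hmul {f g : α → ℕ} (hf : Primrec f) (hg : Primrec g) : Primrec fun a => f a * g a :=
    Primrec.nat_mul.comp hf hg
  have hadd {f g : α → ℕ} (hf : Primrec f) (hg : Primrec g) : Primrec fun a => f a + g a :=
    Primrec.nat_add.comp hf hg
  exact (Primrec.nat_lt.comp (hadd (hmul (hmul hx hp) hv) (hmul (hmul hj hz) hv))
    (hadd (hmul (hmul hu hz) hp) (hmul (hmul hy hp) hv))).decide

theorem primrec_radiusLt {k r : α → ℕ} (hk : Primrec k) (hr : Primrec r) :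
    Primrec fun a => radiusLt (k a) (r a) :=
  (Primrec.nat_lt.comp (Primrec.nat_mul.comp (Primrec.succ.comp (primrec_unpair_fst.comp hr))
    (primrec_two_pow.comp hk)) (Primrec.succ.comp (primrec_unpair_snd.comp hr))).decide

variable {f : ℕ × ℕ × ℕ → ℕ}

theorem computable_ratLt {j d k r : α → ℕ} (hj : Computable j) (hd : Computable d)
    (hk : Computable k) (hr : Computable r) :
    Computable fun a => ratLt (j a) (d a) (k a) (r a) := by
  have h : Primrec fun x : (ℕ × ℕ) × (ℕ × ℕ) => ratLt x.1.1 x.1.2 x.2.1 x.2.2 :=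
    primrec_ratLt (Primrec.fst.comp .fst) (Primrec.snd.comp .fst) (Primrec.fst.comp .snd)
      (Primrec.snd.comp .snd)
  have h' := h.to_comp.comp ((hj.pair hd).pair (hk.pair hr))
  exact h'

theorem computable_centreDist (hf : Computable f) {k a c : α → ℕ} (hk : Computable k)
    (ha : Computable a) (hc : Computable c) :
    Computable fun x => f ((a x).unpair.1, (c x).unpair.1, k x) :=
  hf.comp ((primrec_unpair_fst.to_comp.comp ha).pair ((primrec_unpair_fst.to_comp.comp hc).pair hk))

theorem computable_near (hf : Computable f) {k a c : α → ℕ} (hk : Computable k)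
    (ha : Computable a) (hc : Computable c) : Computable fun x => near f (k x) (a x) (c x) :=
  computable_ratLt (Computable.const 0) (computable_centreDist hf hk ha hc) hk
    (Computable.comp (Primrec₂.natPair.comp (.const 2)
      (Primrec.nat_sub.comp primrec_two_pow (.const 1))).to_comp hk)

theorem computable_inside (hf : Computable f) {k a c : α → ℕ} (hk : Computable k)
    (ha : Computable a) (hc : Computable c) : Computable fun x => inside f (k x) (a x) (c x) :=
  computable_ratLt (Computable.const 9) (computable_centreDist hf hk ha hc) hk
    (primrec_unpair_snd.to_comp.comp hc)

theorem computable_coverTest (hf : Computable f) {k : α → ℕ} {A v : α → List ℕ}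
    (hk : Computable k) (hA : Computable A) (hv : Computable v) :
    Computable fun x => coverTest f (k x) (A x) (v x) := by
  refine Primrec.and.to_comp.comp
    (computable_list_all hA (computable_list_any (hv.comp .fst) ?_))
    (computable_list_all hv (computable_list_any (hA.comp .fst) ?_))
  · exact computable_inside hf (hk.comp (Computable.fst.comp .fst)) (Computable.snd.comp .fst) .snd
  · exact computable_inside hf (hk.comp (Computable.fst.comp .fst)) .snd (Computable.snd.comp .fst)

theorem primrec_defaultCover : Primrec defaultCover :=
  Primrec.list_map .id (Primrec₂.natPair.comp (primrec_unpair_fst.comp .snd) (.const _))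

/-- The sequence of words whose codes are listed in `h`. -/
def wordSeq (h : List ℕ) (n : ℕ) : List ℕ := Denumerable.ofNat (List ℕ) (h.getD n 0)

theorem computable_wordSeq {h : α → List ℕ} {n : α → ℕ} (hh : Computable h) (hn : Computable n) :
    Computable fun x => wordSeq (h x) (n x) :=
  (Computable.ofNat (List ℕ)).comp ((Primrec.list_getD 0).to_comp.comp hh hn)

theorem computable_pieces (hf : Computable f) {L i n : α → ℕ} {h : α → List ℕ}
    (hL : Computable L) (hh : Computable h) (hi : Computable i) (hn : Computable n) :
    Computable fun x => pieces f (L x) (wordSeq (h x)) (i x) (n x) := by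
  have hzero : Computable fun x => (wordSeq (h x) 0)[i x]?.toList :=
    Primrec.optionToList.to_comp.comp
      (Computable.list_getElem?.comp (computable_wordSeq hh (Computable.const 0)) hi)
  have hstep : Computable₂ fun (x : α) (p : ℕ × List ℕ) =>
      (wordSeq (h x) (p.1 + 1)).filter fun c => p.2.any fun a => near f (p.1 + L x) a c := by
    have hp1 : Computable fun y : α × ℕ × List ℕ => y.2.1 := Computable.fst.comp .snd
    refine computable_list_filter (computable_wordSeq (hh.comp .fst) (Computable.succ.comp hp1))
      (computable_list_any ((Computable.snd.comp .snd).comp .fst) ?_)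
    exact computable_near hf (Primrec.nat_add.to_comp.comp
      (hp1.comp (Computable.fst.comp .fst))
      (hL.comp (Computable.fst.comp (Computable.fst.comp .fst)))) .snd (Computable.snd.comp .fst)
  refine (Computable.nat_rec hn hzero hstep).of_eq fun x => ?_
  induction n x with
  | zero => rfl
  | succ m ih => simp only [pieces, ih]

end

/-! ### The realiser -/

section
variable (f : ℕ × ℕ × ℕ → ℕ)

/-- At time `⟨n, c⟩`, the `i`-th component of the output lists the word with code `c`, if the test
at stage `n` accepts it, and a default minimal cover otherwise. -/
def pieceEntry (L : ℕ) (w : ℕ → List ℕ) (i t : ℕ) : ℕ :=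
  bif coverTest f (t.unpair.1 + L) (pieces f L w i t.unpair.1)
      (Denumerable.ofNat (List ℕ) t.unpair.2)
  then t.unpair.2 else Encodable.encode (defaultCover (pieces f L w i 0))

/-- The name of the decomposition obtained from the sequence `w` of covers. -/
def decompositionName (L : ℕ) (w : ℕ → List ℕ) : Baire
  | 0 => (w 0).length + 1
  | m + 1 => pieceEntry f L w m.unpair.1 m.unpair.2

variable {f}

/-- An entry at time `⟨n, c⟩` uses covers only up to level `n`, and unpairing never increases a
number. Finitely many covers thus determine each entry. -/
theorem decompositionName_congr {L : ℕ} {w w' : ℕ → List ℕ} {m : ℕ} (h : ∀ n ≤ m, w n = w' n) :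
    decompositionName f L w m = decompositionName f L w' m := by
  cases m with
  | zero => simp [decompositionName, h]
  | succ m =>
    have hle : m.unpair.2.unpair.1 ≤ m + 1 :=
      ((Nat.unpair_left_le _).trans (Nat.unpair_right_le m)).trans m.le_succ
    simp only [decompositionName, pieceEntry]
    rw [pieces_congr fun n hn => h n (hn.trans hle), pieces_congr fun n hn => h n (hn.trans (by omega))]

theorem computable_decompositionName (hf : Computable f) :
    Computable fun x : ℕ × List ℕ × ℕ => decompositionName f x.1 (wordSeq x.2.1) x.2.2 := by
  have hL : Computable fun x : ℕ × List ℕ × ℕ => x.1 := .fst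
  have hh : Computable fun x : ℕ × List ℕ × ℕ => x.2.1 := Computable.fst.comp .snd
  have hentry : Computable₂ fun (x : ℕ × List ℕ × ℕ) (m : ℕ) =>
      pieceEntry f x.1 (wordSeq x.2.1) m.unpair.1 m.unpair.2 := by
    have hi : Computable fun y : (ℕ × List ℕ × ℕ) × ℕ => y.2.unpair.1 :=
      primrec_unpair_fst.to_comp.comp .snd
    have ht : Computable fun y : (ℕ × List ℕ × ℕ) × ℕ => y.2.unpair.2 :=
      primrec_unpair_snd.to_comp.comp .snd
    have hn := primrec_unpair_fst.to_comp.comp ht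
    have hc := primrec_unpair_snd.to_comp.comp ht
    have hL' := hL.comp (Computable.fst (β := ℕ))
    have hh' := hh.comp (Computable.fst (β := ℕ))
    exact Computable.cond
      (computable_coverTest hf (Primrec.nat_add.to_comp.comp hn hL')
        (computable_pieces hf hL' hh' hi hn) ((Computable.ofNat (List ℕ)).comp hc))
      hc (Computable.encode.comp (primrec_defaultCover.to_comp.comp
        (computable_pieces hf hL' hh' hi (Computable.const 0))))
  refine (Computable.nat_casesOn (Computable.snd.comp .snd) (Computable.succ.comp
    (Computable.list_length.comp (computable_wordSeq hh (Computable.const 0)))) hentry).of_eq ?_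
  rintro ⟨L, h, _ | m⟩ <;> rfl

end

/-! ### Selecting fine covers from a name -/

/-- The word coded by `e` consists of balls of radius less than `2⁻¹ ^ k`. -/
def isFine (k e : ℕ) : Bool := (Denumerable.ofNat (List ℕ) e).all fun c => radiusLt k c.unpair.2

theorem computable_isFine : Computable₂ isFine :=
  computable_list_all ((Computable.ofNat (List ℕ)).comp .snd)
    (primrec_radiusLt (α := (ℕ × ℕ) × ℕ) (Primrec.fst.comp .fst)
      (primrec_unpair_snd.comp .snd)).to_comp

/-- The first position in the first component of `p` of a word with balls of radius less than
`2⁻¹ ^ (n + (p 1 + 5))`. -/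
noncomputable def fineIndex (p : Baire) (n : ℕ) : ℕ :=
  sInf {j | isFine (n + (p 1 + 5)) (p (2 * j)) = true}

/-- The names in which words with arbitrarily small balls occur. -/
def fineNames : Set Baire := {p | ∀ n, ∃ j, isFine (n + (p 1 + 5)) (p (2 * j)) = true}

theorem isFine_fineIndex {p : Baire} (hp : p ∈ fineNames) (n : ℕ) :
    isFine (n + (p 1 + 5)) (p (2 * fineIndex p n)) = true :=
  Nat.sInf_mem (hp n)

theorem computesOn_fineWord : ComputesOn fineNames fun p n => p (2 * fineIndex p n) := by
  have hdouble : Computable fun n : ℕ => 2 * n := (Primrec.nat_mul.comp (.const 2) .id).to_comp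
  have hadd : Computable₂ fun a b : ℕ => a + (b + 5) :=
    (Primrec.nat_add.comp .fst (Primrec.nat_add.comp .snd (.const 5))).to_comp
  have htest : Computable₂ fun k e : ℕ => bif isFine k e then 0 else 1 :=
    Computable.cond computable_isFine (Computable.const 0) (Computable.const 1)
  have hl : ComputesOn fineNames fun p _ => p 1 :=
    ComputesOn.oracle.comp (.of_computable (Computable.const 1))
  refine ComputesOn.oracle.comp (ComputesOn.map hdouble (ComputesOn.find
    (P := fun p n j => isFine (n + (p 1 + 5)) (p (2 * j))) ?_ fun p hp n =>
      ⟨isFine_fineIndex hp n, fun j hj => by simpa using Nat.notMem_of_lt_sInf hj⟩))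
  exact ComputesOn.map₂ htest
    (ComputesOn.map₂ (g := fun a b => a + (b + 5)) hadd (.of_computable primrec_unpair_fst.to_comp) hl)
    (ComputesOn.oracle.comp (.of_computable (hdouble.comp primrec_unpair_snd.to_comp)))

/-- The sequence of covers selected from the name `p`. -/
noncomputable def fineWord (p : Baire) (n : ℕ) : List ℕ :=
  Denumerable.ofNat (List ℕ) (p (2 * fineIndex p n))

theorem computesOn_decompositionName {f : ℕ × ℕ × ℕ → ℕ} (hf : Computable f) :
    ComputesOn fineNames fun p => decompositionName f (p 1 + 5) (fineWord p) := by
  have hl : ComputesOn fineNames fun p _ => p 1 :=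
    ComputesOn.oracle.comp (.of_computable (Computable.const 1))
  have hg : Computable fun e : ℕ => decompositionName f (e.unpair.1 + 5)
      (wordSeq (Denumerable.ofNat (List ℕ) e.unpair.2.unpair.1)) e.unpair.2.unpair.2 := by
    have hL : Computable fun e : ℕ => e.unpair.1 + 5 :=
      (Primrec.nat_add.comp primrec_unpair_fst (.const 5)).to_comp
    have hh : Computable fun e : ℕ => Denumerable.ofNat (List ℕ) e.unpair.2.unpair.1 :=
      (Computable.ofNat (List ℕ)).comp (primrec_unpair_fst.comp primrec_unpair_snd).to_comp
    have hm : Computable fun e : ℕ => e.unpair.2.unpair.2 :=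
      (primrec_unpair_snd.comp primrec_unpair_snd).to_comp
    have h := (computable_decompositionName hf).comp (hL.pair (hh.pair hm))
    exact h
  have h := ComputesOn.map hg (hl.pair ((computesOn_fineWord.map_range.comp
    (.of_computable Computable.succ)).pair (.of_computable Computable.id)))
  -- The program sees only the first `m + 1` covers, which suffice for entry `m`.
  convert h using 3 with p m
  simp only [Nat.unpair_pair, Denumerable.ofNat_encode, id]
  refine decompositionName_congr fun n hn => ?_
  have hn' : n < m + 1 := by omega
  simp [wordSeq, fineWord, hn']

/-! ### Correctness of the realiser -/

section
variable {X : Type*} [MetricSpace X] {C : ComputableMetric X} {f : ℕ × ℕ × ℕ → ℕ}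

/-- A name lists all minimal covers of `K`, and compactness provides some with arbitrarily small
balls; so the search always ends. -/
theorem mem_fineNames {p : Baire} {z : TopologicalSpace.Compacts X × ℕ}
    (hp : ((minCoverRep C).prod natRep).Names p z) : p ∈ fineNames := by
  intro n
  obtain ⟨w, hw, hr⟩ := C.exists_isMinCover_radiusLt z.1.isCompact (n + (p 1 + 5))
  obtain ⟨j, hj⟩ : Encodable.encode w ∈ Set.range fun i => p (2 * i) := by
    rw [show Set.range (fun i => p (2 * i)) = _ from hp.1]
    exact ⟨w, rfl, hw⟩
  refine ⟨j, ?_⟩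
  simp only at hj
  rw [hj, isFine, List.all_eq_true]
  simpa using hr

theorem isFineCoverSeq_fineWord {p : Baire} {z : TopologicalSpace.Compacts X × ℕ}
    (hp : ((minCoverRep C).prod natRep).Names p z) :
    IsFineCoverSeq C (p 1 + 5) (z.1 : Set X) (fineWord p) where
  isMinCover n := by
    obtain ⟨w, hw, hwK⟩ : p (2 * fineIndex p n) ∈ {a | ∃ w : List ℕ, a = Encodable.encode w ∧
        C.IsMinCover w (z.1 : Set X)} := by
      rw [← show Set.range (fun i => p (2 * i)) = _ from hp.1]
      exact ⟨_, rfl⟩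
    rw [fineWord, hw]
    simpa using hwK
  radius_lt n c hc := (radiusLt_iff _ _).1
    (List.all_eq_true.1 (isFine_fineIndex (mem_fineNames hp) n) c hc)

/-- The compact sets obtained from a sequence of covers of `K`; the last one is empty. -/
def decompositionWord (C : ComputableMetric X) (f : ℕ × ℕ × ℕ → ℕ) (L : ℕ)
    (K : TopologicalSpace.Compacts X) (w : ℕ → List ℕ) : List (TopologicalSpace.Compacts X) :=
  (List.range ((w 0).length + 1)).map fun i =>
    ⟨C.limitSet L K (pieces f L w i), C.isCompact_limitSet K.isCompact _⟩

theorem decompositionWord_mem {l : ℕ} {K : TopologicalSpace.Compacts X} {w : ℕ → List ℕ}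
    (hf : C.Approximates f) (hw : IsFineCoverSeq C (l + 5) (K : Set X) w) :
    decompositionWord C f (l + 5) K w ∈ decompositions (K, l) := by
  -- The extra index keeps the word nonempty when `w 0` is empty, as it is for `K = ∅`.
  refine ⟨by simp [decompositionWord], ?_, ?_⟩
  · ext x
    simp only [decompositionWord, List.mem_map, Set.mem_iUnion, exists_prop]
    constructor
    · intro hx
      obtain ⟨i, hi, hxi⟩ := hw.exists_mem_limitSet_of_mem hf hx
      exact ⟨_, ⟨i, List.mem_range.2 (by omega), rfl⟩, hxi⟩
    · rintro ⟨_, ⟨i, -, rfl⟩, hx⟩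
      exact hx.1
  · simp only [decompositionWord, List.mem_map]
    rintro _ ⟨i, -, rfl⟩
    refine IsFineCoverSeq.diam_limitSet_le.trans_lt ?_
    have : (0 : ℝ) < (2 : ℝ)⁻¹ ^ l := by positivity
    -- The shift by `5` turns the diameter bound `16 * 2⁻¹ ^ (l + 5)` into half of `2⁻¹ ^ l`.
    rw [pow_add, show (2 : ℝ)⁻¹ ^ 5 = 1 / 32 by norm_num]
    show _ < (2 : ℝ)⁻¹ ^ l
    linarith

theorem names_decompositionName {L : ℕ} {K : TopologicalSpace.Compacts X} {w : ℕ → List ℕ}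
    (hf : C.Approximates f) (hw : IsFineCoverSeq C L (K : Set X) w) :
    (minCoverRep C).star.Names (decompositionName f L w) (decompositionWord C f L K w) := by
  refine ⟨by simp [decompositionWord, decompositionName], fun i => ?_⟩
  have hget : ((decompositionWord C f L K w).get i : Set X) =
      C.limitSet L K (pieces f L w i) := by
    rw [List.get_eq_getElem]
    simp only [decompositionWord, List.getElem_map, List.getElem_range]
    rfl
  show Set.range (fun j => decompositionName f L w (Nat.pair i j + 1)) = _
  rw [hget]
  ext e
  simp only [decompositionName, Nat.unpair_pair, Set.mem_range, Set.mem_ofPred_eq]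
  constructor
  · rintro ⟨t, rfl⟩
    rw [pieceEntry]
    cases ht : coverTest f (t.unpair.1 + L) (pieces f L w i t.unpair.1)
      (Denumerable.ofNat (List ℕ) t.unpair.2) with
    | true => exact ⟨_, (Denumerable.encode_ofNat _).symm,
        hw.isMinCover_of_coverTest hf K.isCompact ht⟩
    | false => exact ⟨_, rfl, hw.isMinCover_defaultCover hf K.isCompact⟩
  · rintro ⟨v, rfl, hv⟩
    obtain ⟨n, hn⟩ := hw.exists_coverTest hf K.isCompact hv
    -- The word `v` is listed at the time pairing its code with a stage that accepts it.
    exact ⟨Nat.pair n (Encodable.encode v), by simp [pieceEntry, hn]⟩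

end

end CompMetric

theorem theorem8p2 {X : Type*} [MetricSpace X] (C : CompMetric.ComputableMetric X) :
    (∀ z : TopologicalSpace.Compacts X × ℕ, (CompMetric.decompositions z).Nonempty) ∧
    CompMetric.IsComputable
      ((CompMetric.minCoverRep C).prod CompMetric.natRep)
      (CompMetric.minCoverRep C).star
      CompMetric.decompositions := by
  obtain ⟨f, hf, hfC⟩ := C.computable_dist
  have key : ∀ p z, ((CompMetric.minCoverRep C).prod CompMetric.natRep).Names p z →
      CompMetric.decompositionWord C f (p 1 + 5) z.1 (CompMetric.fineWord p) ∈
        CompMetric.decompositions z := by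
    rintro p ⟨K, l⟩ hp
    have hl : p 1 = l := hp.2
    have hw := CompMetric.isFineCoverSeq_fineWord hp
    rw [hl] at hw ⊢
    exact CompMetric.decompositionWord_mem hfC hw
  refine ⟨fun z => ?_, ?_⟩
  -- Totality comes from the same construction, applied to any name of `z`.
  · obtain ⟨p, hp⟩ := ((CompMetric.minCoverRep C).prod CompMetric.natRep).exists_name z
    exact ⟨_, key p z hp⟩
  · obtain ⟨F, hF, hFD⟩ := (CompMetric.computesOn_decompositionName hf).exists_computableOnBaire
    exact ⟨F, hF, fun p z hp _ => ⟨_, hFD p (CompMetric.mem_fineNames hp), _, key p z hp,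
      CompMetric.names_decompositionName hfC (CompMetric.isFineCoverSeq_fineWord hp)⟩⟩
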